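/- Let $m$ be a number of bosonic modes with Hilbert space $L^2(\mathbb{R}^m)$, quadratures $\hat R=(\hat X_1,\hat P_1,\dots,\hat X_m,\hat P_m)$ with $[\hat X_j,\hat P_k]=i\delta_{jk}$, and displacement operators $D(r)=\exp(i\,r\cdot\hat R)$, $r\in\mathbb{R}^{2m}$. For a trace-class operator $A$ let $\chi_A(r)=\mathrm{tr}[D(r)A]$, $(d_A)_j=\mathrm{tr}(\hat R_jA)$ and $(\Gamma_A)_{jk}=\mathrm{tr}(\{\hat R_j-(d_A)_j,\hat R_k-(d_A)_k\}_+A)$ be its characteristic function, displacement and (possibly complex) covariance matrix, where for a polynomial $q$ in the quadratures $\mathrm{tr}(qA)$ is understood as the trace of the trace-class extension of $Aq$ from the Schwartz space to $L^2(\mathbb{R}^m)$ (the moment is called finite if this extension exists). Let $\Pi$ be a Gaussian filter, that is, $\Pi=cG$ with $c>0$ and $G$ a density operator with $\chi_G(r)=\exp(-r^T\Gamma r/4)$ for some real symmetric matrix $\Gamma$. Let $\rho$ be a density operator with $\mathrm{tr}(\rho\Pi)\neq 0$, and put $\sigma=\rho\Pi/\mathrm{tr}(\rho\Pi)$ (in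 general not Hermitian). Suppose that $\sigma$ has zero displacement, $d_\sigma=0$, and that for some $r_0\in\mathbb{R}^{2m}$ the function $f(t)=\chi_\sigma(t r_0)=\mathrm{tr}[D(t r_0)\sigma]$ satisfies $|f(t)|\le 1$ for all $t\in\mathbb{R}$. Then all first and second moments of $\sigma$ are finite, and with $\nu=r_0^T\Gamma_\sigma r_0\in\mathbb{C}$ we have, for every $t\in\mathbb{R}$, $$\lim_{N\to\infty} f(t/\sqrt N)^N=e^{-\nu t^2/4}.$$ -/

import Mathlib

open MeasureTheory Filter Topology
open scoped SchwartzMap InnerProductSpace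

noncomputable section

namespace Gaussification

/-! ### Trace-class operators -/

section Trace

variable {H : Type*} [NormedAddCommGroup H] [InnerProductSpace ℂ H]

/-- A bounded operator on a Hilbert space is trace class (nuclear): it is an absolutely convergent
sum of rank-one operators `x ↦ ⟪v n, x⟫ u n`. -/
def IsTraceClass (A : H →L[ℂ] H) : Prop :=
  ∃ u v : ℕ → H, Summable (fun n => ‖u n‖ * ‖v n‖) ∧
    ∀ x, HasSum (fun n => ⟪v n, x⟫_ℂ • u n) (A x)

variable [CompleteSpace H]

/-- The trace `∑ᵢ ⟪bᵢ, A bᵢ⟫` over an orthonormal basis `b`; for a trace-class operator the sum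
converges absolutely and does not depend on `b`. -/
def trace (A : H →L[ℂ] H) : ℂ :=
  ∑' i, ⟪(exists_hilbertBasis ℂ H).choose_spec.choose i,
    A ((exists_hilbertBasis ℂ H).choose_spec.choose i)⟫_ℂ

/-- A density operator (quantum state): positive, trace class, of trace one. -/
structure IsDensityOperator (ρ : H →L[ℂ] H) : Prop where
  isPositive : ρ.IsPositive
  isTraceClass : IsTraceClass ρ
  trace_eq_one : trace ρ = 1

end Trace

/-! ### The `m`-mode system: phase space, quadratures, displacement operators -/

/-- The configuration space `ℝᵐ`. -/
abbrev Config (m : ℕ) : Type := EuclideanSpace ℝ (Fin m)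

/-- The Hilbert space `L²(ℝᵐ, ℂ)` of `m` bosonic modes. -/
abbrev Fock (m : ℕ) : Type := Lp ℂ 2 (volume : Measure (Config m))

/-- Phase-space coordinates, in the order `(X₁, P₁, …, X_m, P_m)`:
`(j, 0)` is the position and `(j, 1)` the momentum of mode `j`. -/
abbrev Coord (m : ℕ) : Type := Fin m × Fin 2

/-- The phase space `ℝ²ᵐ`. -/
abbrev PhaseSpace (m : ℕ) : Type := Coord m → ℝ

variable {m : ℕ}

/-- The position part of a phase-space vector. -/
def posPart (r : PhaseSpace m) : Config m := WithLp.toLp 2 fun j => r (j, 0)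

/-- The momentum part of a phase-space vector. -/
def momPart (r : PhaseSpace m) : Config m := WithLp.toLp 2 fun j => r (j, 1)

theorem hasTemperateGrowth_coord (j : Fin m) :
    (fun x : Config m => ((x j : ℝ) : ℂ)).HasTemperateGrowth :=
  (Complex.ofRealCLM ∘L (EuclideanSpace.proj j : Config m →L[ℝ] ℝ)).hasTemperateGrowth

/-- The quadrature operators on the Schwartz space: `R (j, 0) = X_j` is multiplication by the
`j`-th coordinate and `R (j, 1) = P_j = -i ∂_j`, so that `[X_j, P_k] = i δ_{jk}`. -/
def R (a : Coord m) : 𝓢(Config m, ℂ) →L[ℂ] 𝓢(Config m, ℂ) :=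
  if a.2 = 0 then SchwartzMap.smulLeftCLM ℂ (fun x : Config m => ((x a.1 : ℝ) : ℂ))
  else (-Complex.I) • LineDeriv.lineDerivOpCLM ℂ 𝓢(Config m, ℂ) (EuclideanSpace.single a.1 (1 : ℝ))

theorem R_pos_apply (j : Fin m) (ψ : 𝓢(Config m, ℂ)) (x : Config m) :
    R (j, 0) ψ x = (x j : ℂ) * ψ x := by
  simp [R, hasTemperateGrowth_coord]

theorem R_mom_apply (j : Fin m) (ψ : 𝓢(Config m, ℂ)) (x : Config m) :
    R (j, 1) ψ x = -Complex.I * lineDeriv ℝ ψ x (EuclideanSpace.single j (1 : ℝ)) := by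
  simp [R, LineDeriv.lineDerivOpCLM_apply, SchwartzMap.lineDerivOp_apply]

/-- The phase by which the displacement operator multiplies. -/
def weylPhase (r : PhaseSpace m) (x : Config m) : ℂ :=
  Complex.exp (Complex.I * ((⟪posPart r, x⟫_ℝ + ⟪posPart r, momPart r⟫_ℝ / 2 : ℝ) : ℂ))

theorem norm_weylPhase (r : PhaseSpace m) (x : Config m) : ‖weylPhase r x‖ = 1 := by
  rw [weylPhase, mul_comm, Complex.norm_exp_ofReal_mul_I]

theorem continuous_weylPhase (r : PhaseSpace m) : Continuous (weylPhase r) := by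
  unfold weylPhase
  fun_prop

theorem memLp_weyl (r : PhaseSpace m) (ψ : Fock m) :
    MemLp (fun x => weylPhase r x * ψ (x + momPart r)) 2 (volume : Measure (Config m)) := by
  have h1 : MemLp (fun x => ψ (x + momPart r)) 2 (volume : Measure (Config m)) :=
    (Lp.memLp ψ).comp_measurePreserving (measurePreserving_add_right volume (momPart r))
  refine MemLp.of_le h1 ((continuous_weylPhase r).aestronglyMeasurable.mul h1.1) ?_
  exact Eventually.of_forall fun x => by simp [norm_weylPhase]

/-- The displacement operator `D(r) = exp(i r · R)` in the Schrödinger representation. For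
`r = (ξ, η)`, with position part `ξ` and momentum part `η`, it is
`(D(r) ψ)(x) = exp(i (ξ · x + ξ · η / 2)) ψ(x + η)`; `t ↦ D(t r)` is the one-parameter
unitary group generated by `r · R`. -/
def D (r : PhaseSpace m) : Fock m →L[ℂ] Fock m :=
  LinearIsometry.toContinuousLinearMap
    { toFun := fun ψ => (memLp_weyl r ψ).toLp _
      map_add' := fun ψ φ => by
        rw [← MemLp.toLp_add]
        refine MemLp.toLp_congr _ _ ?_
        have h := (measurePreserving_add_right volume (momPart r)).quasiMeasurePreserving.ae
          (Lp.coeFn_add ψ φ)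
        filter_upwards [h] with x hx
        simp only [hx, Pi.add_apply, mul_add]
      map_smul' := fun c ψ => by
        rw [RingHom.id_apply, ← MemLp.toLp_const_smul]
        refine MemLp.toLp_congr _ _ ?_
        have h := (measurePreserving_add_right volume (momPart r)).quasiMeasurePreserving.ae
          (Lp.coeFn_smul c ψ)
        filter_upwards [h] with x hx
        simp only [hx, Pi.smul_apply, smul_eq_mul]
        ring
      norm_map' := fun ψ => by
        have h1 : MemLp (fun x => ψ (x + momPart r)) 2 (volume : Measure (Config m)) :=
          (Lp.memLp ψ).comp_measurePreserving (measurePreserving_add_right volume (momPart r))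
        change ‖(memLp_weyl r ψ).toLp _‖ = ‖ψ‖
        rw [Lp.norm_toLp, Lp.norm_def]
        congr 1
        rw [← eLpNorm_comp_measurePreserving (Lp.aestronglyMeasurable ψ)
          (measurePreserving_add_right volume (momPart r))]
        refine eLpNorm_congr_norm_ae (Eventually.of_forall fun x => ?_)
        simp [norm_weylPhase] }

theorem coeFn_D (r : PhaseSpace m) (ψ : Fock m) :
    D r ψ =ᵐ[volume] fun x => weylPhase r x * ψ (x + momPart r) :=
  (memLp_weyl r ψ).coeFn_toLp

/-! ### Characteristic functions and moments -/

/-- The characteristic function `χ_A(r) = tr(D(r) A)`. -/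
def charFn (A : Fock m →L[ℂ] Fock m) (r : PhaseSpace m) : ℂ := trace (D r ∘L A)

/-- `T` is the bounded operator `A q`: a trace-class operator that agrees with `A q` on the
(dense) Schwartz space, where `q` is a polynomial in the quadratures. -/
def IsMomentOperator (A : Fock m →L[ℂ] Fock m) (q : 𝓢(Config m, ℂ) →L[ℂ] 𝓢(Config m, ℂ))
    (T : Fock m →L[ℂ] Fock m) : Prop :=
  IsTraceClass T ∧ ∀ ψ : 𝓢(Config m, ℂ), T (ψ.toLp 2) = A ((q ψ).toLp 2)

/-- The moment `tr(q A)` is finite: `A q` extends to a trace-class operator. -/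
def HasFiniteMoment (A : Fock m →L[ℂ] Fock m) (q : 𝓢(Config m, ℂ) →L[ℂ] 𝓢(Config m, ℂ)) : Prop :=
  ∃ T, IsMomentOperator A q T

open Classical in
/-- The moment `tr(q A) = tr(A q)` of a polynomial `q` in the quadratures (and `0` if it is not
finite). The extension of `A q` is unique as the Schwartz space is dense. -/
def moment (A : Fock m →L[ℂ] Fock m) (q : 𝓢(Config m, ℂ) →L[ℂ] 𝓢(Config m, ℂ)) : ℂ :=
  if h : HasFiniteMoment A q then trace h.choose else 0

/-- The first moments `d_A = (tr(R_j A))_j`, the displacement of `A`. -/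
def displacement (A : Fock m →L[ℂ] Fock m) (j : Coord m) : ℂ := moment A (R j)

/-- The anticommutator `{R_j - d_j, R_k - d_k}₊`. -/
def centredAnticomm (d : Coord m → ℂ) (j k : Coord m) :
    𝓢(Config m, ℂ) →L[ℂ] 𝓢(Config m, ℂ) :=
  (R j - d j • ContinuousLinearMap.id ℂ _) ∘L (R k - d k • ContinuousLinearMap.id ℂ _) +
    (R k - d k • ContinuousLinearMap.id ℂ _) ∘L (R j - d j • ContinuousLinearMap.id ℂ _)

/-- The first and second moments of `A` are finite. -/
def HasFiniteSecondMoments (A : Fock m →L[ℂ] Fock m) : Prop :=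
  (∀ j, HasFiniteMoment A (R j)) ∧
    ∀ j k, HasFiniteMoment A (centredAnticomm (displacement A) j k)

/-- The (in general complex) covariance matrix
`(Γ_A)_{jk} = tr({R_j - d_j, R_k - d_k}₊ A)`. -/
def covarianceMatrix (A : Fock m →L[ℂ] Fock m) : Matrix (Coord m) (Coord m) ℂ :=
  Matrix.of fun j k => moment A (centredAnticomm (displacement A) j k)

/-- A Gaussian state with vanishing first moments: a density operator with characteristic function
`exp(-rᵀ Γ r / 4)` for a real symmetric matrix `Γ`. -/
def IsCentredGaussianState (G : Fock m →L[ℂ] Fock m) : Prop :=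
  IsDensityOperator G ∧ ∃ Γ : Matrix (Coord m) (Coord m) ℝ, Γ.IsSymm ∧
    ∀ r, charFn G r = Complex.exp (-((r ⬝ᵥ Γ.mulVec r : ℝ) : ℂ) / 4)

/-- A Gaussian filter: a positive multiple of a Gaussian state with vanishing first moments.
(Neither separability nor invertibility is needed here.) -/
def IsGaussianFilter (P : Fock m →L[ℂ] Fock m) : Prop :=
  ∃ (c : ℝ) (G : Fock m →L[ℂ] Fock m), 0 < c ∧ IsCentredGaussianState G ∧ P = (c : ℂ) • G

/-- The operator `σ = ρ Π / tr(ρ Π)`. -/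
def filtered (ρ P : Fock m →L[ℂ] Fock m) : Fock m →L[ℂ] Fock m := (trace (ρ ∘L P))⁻¹ • (ρ ∘L P)

/-- The second moment `ν = r₀ᵀ Γ_A r₀` of `A` along the phase-space direction `r₀`. -/
def secondMoment (A : Fock m →L[ℂ] Fock m) (r₀ : PhaseSpace m) : ℂ :=
  (fun j => (r₀ j : ℂ)) ⬝ᵥ (covarianceMatrix A).mulVec (fun j => (r₀ j : ℂ))

end Gaussification

end

open MeasureTheory Filter Topology
open scoped SchwartzMap InnerProductSpace

noncomputable section

/-! Along the direction `r₀` the statement is a central limit theorem: if `f` is differentiable,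
`f'` is differentiable at 0, `f 0 = 1` and `f' 0 = 0`, then `f (t/√N)^N` tends to `exp (f''(0)
t²/2)` (`tendsto_pow_of_hasDerivAt`). It remains to differentiate `f` twice and to find `f''(0) =
-ν/2`.

The smoothness comes from the filter alone. By cyclicity `f s` is a constant times `tr (G D(s r₀)
ρ)`, so it is enough that `G X` and `G X²`, with `X = r₀ · R`, extend to bounded operators; the
trace-class `ρ` then supplies the summability. For positive `G`, `‖G A‖² ≤ ‖G‖ tr (A A† G)`
(`norm_comp_apply_sq_le`). When `A` is a first or second difference of displacements, the right-hand
trace is a combination of values of the Gaussian characteristic function, of order `h²` or `h² k²`.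
Hence the difference quotients of `G D(h r₀)` are uniformly bounded. They converge on Schwartz
functions, and by density everywhere (`exists_extension_of_difference_bound`).

The bounded extensions also make all moments finite and identify `f'(0)` and `f''(0)` with the first
and second moments along `r₀`. -/

namespace Gaussification

/-! ### Nuclear operators, the trace, and a norm bound through the trace -/

section TraceTheory

variable {H : Type*} [NormedAddCommGroup H] [InnerProductSpace ℂ H]

/-- `A` is the absolutely convergent sum of the rank-one operators `x ↦ ⟪v n, x⟫ u n`. -/
structure IsNuclearSum (A : H →L[ℂ] H) (u v : ℕ → H) : Prop where
  summable : Summable fun n => ‖u n‖ * ‖v n‖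
  hasSum : ∀ x, HasSum (fun n => ⟪v n, x⟫_ℂ • u n) (A x)

theorem IsNuclearSum.isTraceClass {A : H →L[ℂ] H} {u v : ℕ → H} (h : IsNuclearSum A u v) :
    IsTraceClass A :=
  ⟨u, v, h.summable, h.hasSum⟩

theorem IsTraceClass.exists_isNuclearSum {A : H →L[ℂ] H} (h : IsTraceClass A) :
    ∃ u v, IsNuclearSum A u v :=
  let ⟨u, v, hs, hA⟩ := h
  ⟨u, v, hs, hA⟩

theorem IsNuclearSum.comp_left {A : H →L[ℂ] H} {u v : ℕ → H} (h : IsNuclearSum A u v)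
    (B : H →L[ℂ] H) : IsNuclearSum (B ∘L A) (fun n => B (u n)) v where
  summable := by
    refine Summable.of_nonneg_of_le (fun n => by positivity) (fun n => ?_)
      (h.summable.mul_left ‖B‖)
    rw [← mul_assoc]
    gcongr
    exact B.le_opNorm _
  hasSum x := by simpa using B.hasSum (h.hasSum x)

theorem IsNuclearSum.smul {A : H →L[ℂ] H} {u v : ℕ → H} (h : IsNuclearSum A u v) (c : ℂ) :
    IsNuclearSum (c • A) (fun n => c • u n) v := by
  simpa using! h.comp_left (c • ContinuousLinearMap.id ℂ H)

/-- Cauchy–Schwarz and Bessel on finite sets. The absolute form is what allows sums to be exchanged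
in the trace. -/
theorem summable_norm_inner_mul_inner {ι : Type*} {b : ι → H} (hb : Orthonormal ℂ b) (x y : H) :
    Summable (fun i => ‖⟪x, b i⟫_ℂ * ⟪b i, y⟫_ℂ‖) ∧
      ∑' i, ‖⟪x, b i⟫_ℂ * ⟪b i, y⟫_ℂ‖ ≤ ‖x‖ * ‖y‖ := by
  have key : ∀ s : Finset ι, ∑ i ∈ s, ‖⟪x, b i⟫_ℂ * ⟪b i, y⟫_ℂ‖ ≤ ‖x‖ * ‖y‖ := fun s => by
    simp only [norm_mul]
    refine (Real.sum_mul_le_sqrt_mul_sqrt s _ _).trans ?_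
    gcongr
    · refine Real.sqrt_le_iff.2 ⟨norm_nonneg _, ?_⟩
      simpa only [norm_inner_symm x] using hb.sum_inner_products_le x
    · exact Real.sqrt_le_iff.2 ⟨norm_nonneg _, hb.sum_inner_products_le y⟩
  exact ⟨summable_of_sum_le (fun i => norm_nonneg _) key,
    Real.tsum_le_of_sum_le (fun i => norm_nonneg _) key⟩

/-- The trace of a nuclear operator over any Hilbert basis. -/
theorem IsNuclearSum.hasSum_inner {A : H →L[ℂ] H} {u v : ℕ → H} (h : IsNuclearSum A u v)
    {ι : Type*} (b : HilbertBasis ι ℂ H) :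
    HasSum (fun i => ⟪b i, A (b i)⟫_ℂ) (∑' n, ⟪v n, u n⟫_ℂ) := by
  -- The double series converges absolutely, so it may be summed over the basis first, giving `⟪v n,
  -- u n⟫`, or over `n` first, giving the diagonal entries of `A`.
  have hsum : Summable fun p : ℕ × ι => ⟪v p.1, b p.2⟫_ℂ * ⟪b p.2, u p.1⟫_ℂ := by
    refine Summable.of_norm ((summable_prod_of_nonneg fun _ => norm_nonneg _).2
      ⟨fun n => (summable_norm_inner_mul_inner b.orthonormal (v n) (u n)).1, ?_⟩)
    refine Summable.of_nonneg_of_le (fun n => tsum_nonneg fun _ => norm_nonneg _) (fun n => ?_)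
      h.summable
    rw [mul_comm]
    exact (summable_norm_inner_mul_inner b.orthonormal (v n) (u n)).2
  obtain ⟨S, hS⟩ := hsum
  have h1 : HasSum (fun n => ⟪v n, u n⟫_ℂ) S :=
    hS.prod_fiberwise fun n => b.hasSum_inner_mul_inner (v n) (u n)
  rw [h1.tsum_eq]
  refine ((Equiv.prodComm ι ℕ).hasSum_iff.2 hS).prod_fiberwise fun i => ?_
  simpa [inner_smul_right] using (innerSL ℂ (b i)).hasSum (h.hasSum (b i))

theorem IsNuclearSum.summable_inner {A : H →L[ℂ] H} {u v : ℕ → H} (h : IsNuclearSum A u v)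
    (B : H →L[ℂ] H) : Summable fun n => ⟪v n, B (u n)⟫_ℂ := by
  refine Summable.of_norm_bounded (h.comp_left B).summable fun n => ?_
  rw [mul_comm]
  exact norm_inner_le_norm _ _

theorem IsTraceClass.comp_left {A : H →L[ℂ] H} (h : IsTraceClass A) (B : H →L[ℂ] H) :
    IsTraceClass (B ∘L A) :=
  let ⟨_, _, h⟩ := h.exists_isNuclearSum
  (h.comp_left B).isTraceClass

theorem IsTraceClass.smul {A : H →L[ℂ] H} (h : IsTraceClass A) (c : ℂ) : IsTraceClass (c • A) :=
  let ⟨_, _, h⟩ := h.exists_isNuclearSum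
  (h.smul c).isTraceClass

/-- A positive bounded operator satisfies `‖G x‖² ≤ ‖G‖ ⟪x, G x⟫`. -/
theorem norm_sq_le_of_isPositive {G : H →L[ℂ] H} (hG : G.IsPositive) (x : H) :
    ‖G x‖ ^ 2 ≤ ‖G‖ * (⟪x, G x⟫_ℂ).re := by
  rcases (norm_nonneg G).eq_or_lt' with h0 | hpos
  · simp [norm_eq_zero.1 h0]
  have hsymm : ∀ y z, ⟪G y, z⟫_ℂ = ⟪y, G z⟫_ℂ := hG.isSymmetric
  -- Positivity is tested at `x - ‖G‖⁻¹ G x`, one gradient step for the quadratic form.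
  have h := hG.re_inner_nonneg_right (x - ((‖G‖⁻¹ : ℝ) : ℂ) • G x)
  have hn : (⟪G x, G (G x)⟫_ℂ).re ≤ ‖G‖ * ‖G x‖ ^ 2 := by
    refine (Complex.re_le_norm _).trans ((norm_inner_le_norm _ _).trans ?_)
    nlinarith [G.le_opNorm (G x), norm_nonneg (G x)]
  have hs : (⟪G x, G x⟫_ℂ).re = ‖G x‖ ^ 2 := by
    rw [inner_self_eq_norm_sq_to_K]; norm_cast
  have e : (⟪x - ((‖G‖⁻¹ : ℝ) : ℂ) • G x, G (x - ((‖G‖⁻¹ : ℝ) : ℂ) • G x)⟫_ℂ).re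
      = (⟪x, G x⟫_ℂ).re - 2 * ‖G‖⁻¹ * ‖G x‖ ^ 2 + ‖G‖⁻¹ * ‖G‖⁻¹ * (⟪G x, G (G x)⟫_ℂ).re := by
    simp only [map_sub, map_smul, inner_sub_left, inner_sub_right, inner_smul_left,
      inner_smul_right, Complex.conj_ofReal, Complex.sub_re, Complex.re_ofReal_mul, ← hsymm x, hs]
    ring
  have h' : 0 ≤ (⟪x, G x⟫_ℂ).re - 2 * ‖G‖⁻¹ * ‖G x‖ ^ 2
      + ‖G‖⁻¹ * ‖G‖⁻¹ * (⟪G x, G (G x)⟫_ℂ).re := e ▸ h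
  have h3 : ‖G‖⁻¹ * ‖G‖⁻¹ * (⟪G x, G (G x)⟫_ℂ).re ≤ ‖G‖⁻¹ * ‖G x‖ ^ 2 := by
    calc _ ≤ ‖G‖⁻¹ * ‖G‖⁻¹ * (‖G‖ * ‖G x‖ ^ 2) := by gcongr
      _ = _ := by field_simp
  have h4 : ‖G‖⁻¹ * ‖G x‖ ^ 2 ≤ (⟪x, G x⟫_ℂ).re := by linarith
  rwa [inv_mul_le_iff₀ hpos] at h4

variable [CompleteSpace H]

theorem IsNuclearSum.comp_right {A : H →L[ℂ] H} {u v : ℕ → H} (h : IsNuclearSum A u v)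
    (B : H →L[ℂ] H) :
    IsNuclearSum (A ∘L B) u (fun n => ContinuousLinearMap.adjoint B (v n)) where
  summable := by
    refine Summable.of_nonneg_of_le (fun n => by positivity) (fun n => ?_)
      (h.summable.mul_left ‖ContinuousLinearMap.adjoint B‖)
    rw [mul_left_comm]
    gcongr
    exact ContinuousLinearMap.le_opNorm _ _
  hasSum x := by simpa [ContinuousLinearMap.adjoint_inner_left] using h.hasSum (B x)

theorem IsNuclearSum.trace_eq {A : H →L[ℂ] H} {u v : ℕ → H} (h : IsNuclearSum A u v) :
    trace A = ∑' n, ⟪v n, u n⟫_ℂ :=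
  (h.hasSum_inner _).tsum_eq

theorem IsNuclearSum.trace_comp_left {A : H →L[ℂ] H} {u v : ℕ → H} (h : IsNuclearSum A u v)
    (B : H →L[ℂ] H) : trace (B ∘L A) = ∑' n, ⟪v n, B (u n)⟫_ℂ :=
  (h.comp_left B).trace_eq

theorem IsNuclearSum.trace_comp_right {A : H →L[ℂ] H} {u v : ℕ → H} (h : IsNuclearSum A u v)
    (B : H →L[ℂ] H) : trace (A ∘L B) = ∑' n, ⟪v n, B (u n)⟫_ℂ := by
  simp [(h.comp_right B).trace_eq, ContinuousLinearMap.adjoint_inner_left]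

theorem trace_smul (c : ℂ) (A : H →L[ℂ] H) : trace (c • A) = c * trace A := by
  simp [trace, tsum_mul_left]

theorem IsTraceClass.trace_comp_comm {A : H →L[ℂ] H} (h : IsTraceClass A) (B : H →L[ℂ] H) :
    trace (A ∘L B) = trace (B ∘L A) := by
  obtain ⟨u, v, h⟩ := h.exists_isNuclearSum
  rw [h.trace_comp_right, h.trace_comp_left]

theorem IsTraceClass.comp_right {A : H →L[ℂ] H} (h : IsTraceClass A) (B : H →L[ℂ] H) :
    IsTraceClass (A ∘L B) :=
  let ⟨_, _, h⟩ := h.exists_isNuclearSum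
  (h.comp_right B).isTraceClass

theorem IsTraceClass.trace_add_comp {A : H →L[ℂ] H} (h : IsTraceClass A) (B C : H →L[ℂ] H) :
    trace ((B + C) ∘L A) = trace (B ∘L A) + trace (C ∘L A) := by
  obtain ⟨u, v, h⟩ := h.exists_isNuclearSum
  simp only [h.trace_comp_left, add_apply, inner_add_right]
  exact (h.summable_inner B).tsum_add (h.summable_inner C)

/-- Composition with a trace-class operator followed by the trace, as a linear functional. -/
def traceComp (A : H →L[ℂ] H) (h : IsTraceClass A) : (H →L[ℂ] H) →ₗ[ℂ] ℂ where
  toFun B := trace (B ∘L A)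
  map_add' B C := h.trace_add_comp B C
  map_smul' c B := trace_smul c (B ∘L A)

theorem traceComp_apply (A : H →L[ℂ] H) (h : IsTraceClass A) (B : H →L[ℂ] H) :
    traceComp A h B = trace (B ∘L A) := rfl

/-- The quadratic form of a positive trace-class operator is dominated by its trace. -/
theorem inner_le_trace_of_isPositive {T : H →L[ℂ] H} (hT : IsTraceClass T) (hpos : T.IsPositive)
    (x : H) : (⟪x, T x⟫_ℂ).re ≤ (trace T).re * ‖x‖ ^ 2 := by
  obtain ⟨u, v, h⟩ := hT.exists_isNuclearSum
  have key : ∀ y : H, ‖y‖ = 1 → (⟪y, T y⟫_ℂ).re ≤ (trace T).re := fun y hy => by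
    -- A unit vector is completed to a Hilbert basis; its diagonal entry is one of the nonnegative
    -- terms of the trace.
    have ho : Orthonormal ℂ ((↑) : ({y} : Set H) → H) := by
      refine ⟨fun a => ?_, fun a b hab => absurd (Subsingleton.elim a b) hab⟩
      rw [Set.mem_singleton_iff.1 a.2, hy]
    obtain ⟨w, b, hw, hb⟩ := ho.exists_hilbertBasis_extension
    have hs := Complex.hasSum_re (h.hasSum_inner b)
    rw [← h.trace_eq] at hs
    have := le_hasSum hs ⟨y, hw rfl⟩ fun i _ => hpos.re_inner_nonneg_right _
    simpa [hb] using this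
  rcases eq_or_ne x 0 with rfl | hx
  · simp
  have hx' : ‖x‖ ≠ 0 := norm_ne_zero_iff.2 hx
  have h1 := key (((‖x‖⁻¹ : ℝ) : ℂ) • x) (by
    rw [norm_smul, Complex.norm_real, norm_inv, norm_norm, inv_mul_cancel₀ hx'])
  rw [map_smul, inner_smul_left, inner_smul_right, Complex.conj_ofReal, ← mul_assoc,
    ← Complex.ofReal_mul, Complex.re_ofReal_mul] at h1
  have h2 : (⟪x, T x⟫_ℂ).re = ‖x‖ ^ 2 * (‖x‖⁻¹ * ‖x‖⁻¹ * (⟪x, T x⟫_ℂ).re) := by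
    field_simp
  rw [h2, mul_comm]
  gcongr

/-- If `G` is positive and trace class then `‖G A‖² ≤ ‖G‖ tr(A A† G)`. -/
theorem norm_comp_apply_sq_le {G : H →L[ℂ] H} (hG : G.IsPositive) (hc : IsTraceClass G)
    (A : H →L[ℂ] H) (x : H) :
    ‖G (A x)‖ ^ 2 ≤
      ‖G‖ * (trace ((A ∘L ContinuousLinearMap.adjoint A) ∘L G)).re * ‖x‖ ^ 2 := by
  refine (norm_sq_le_of_isPositive hG (A x)).trans ?_
  rw [mul_assoc]
  gcongr
  -- The form `⟪A x, G A x⟫` is that of the positive operator `A† G A`, whose trace is `tr (A A† G)`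
  -- by cyclicity.
  have h := inner_le_trace_of_isPositive
    (T := ContinuousLinearMap.adjoint A ∘L (G ∘L A))
    ((hc.comp_right A).comp_left _) (by simpa using! hG.adjoint_conj A) x
  rw [ContinuousLinearMap.comp_apply, ContinuousLinearMap.adjoint_inner_right,
    ← (hc.comp_right A).trace_comp_comm, ContinuousLinearMap.comp_assoc,
    hc.trace_comp_comm] at h
  exact h

end TraceTheory

/-! ### Powers of a function with a second-order expansion; Gaussian differences -/

section ScalarEstimates

/-- The expansion `f s = 1 + c s²/2 + o(s²)` gives `N (f (t/√N) - 1) → c t²/2`, and the limit of `(1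
+ z_N/N)^N` applies, also for complex `c`. -/
theorem tendsto_pow_of_hasDerivAt {f f' : ℝ → ℂ} {c : ℂ} (hf : ∀ t, HasDerivAt f (f' t) t)
    (hf' : HasDerivAt f' c 0) (h0 : f 0 = 1) (h0' : f' 0 = 0) (t : ℝ) :
    Tendsto (fun N : ℕ => f (t / √(N : ℝ)) ^ N) atTop (𝓝 (Complex.exp (c * (t : ℂ) ^ 2 / 2))) := by
  have hlo : (fun s : ℝ => f s - 1 - c * (s : ℂ) ^ 2 / 2) =o[𝓝 0] fun s : ℝ => s ^ 2 := by
    refine Asymptotics.isLittleO_iff.2 fun ε hε => ?_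
    have h1 := (hasDerivAt_iff_isLittleO.1 hf').def hε
    obtain ⟨δ, hδ, h2⟩ := Metric.eventually_nhds_iff.1 h1
    refine Metric.eventually_nhds_iff.2 ⟨δ, hδ, fun s hs => ?_⟩
    -- The remainder has derivative `f' y - y c`, at most `ε |s|` on the ball of radius `|s|`; the
    -- mean value inequality gives `ε s²`.
    have hd : ∀ y ∈ Metric.closedBall (0 : ℝ) |s|,
        HasDerivWithinAt (fun s : ℝ => f s - 1 - c * (s : ℂ) ^ 2 / 2) (f' y - y * c)
          (Metric.closedBall (0 : ℝ) |s|) y := fun y _ => by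
      have h3 : HasDerivAt (fun s : ℝ => (s : ℂ) ^ 2) (2 * (y : ℂ)) y := by
        have := ((Complex.ofRealCLM.hasDerivAt (x := y)).fun_pow 2)
        simp only [Complex.ofRealCLM_apply] at this
        exact this.congr_deriv (by simp)
      refine HasDerivAt.hasDerivWithinAt ?_
      refine HasDerivAt.congr_deriv (((hf y).sub_const 1).sub ((h3.const_mul c).div_const 2)) ?_
      ring
    have hb : ∀ y ∈ Metric.closedBall (0 : ℝ) |s|, ‖f' y - y * c‖ ≤ ε * |s| := fun y hy => by
      have hy' : |y| ≤ |s| := by simpa using hy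
      have h4 := h2 (y := y) (by simpa using hy'.trans_lt (by simpa using hs))
      refine le_trans (by simpa [h0'] using h4) (by gcongr)
    have h5 := (convex_closedBall (0 : ℝ) |s|).norm_image_sub_le_of_norm_hasDerivWithin_le hd hb
      (x := 0) (y := s) (by simp) (by simp)
    simpa [h0, mul_assoc, ← sq] using h5
  have hs : Tendsto (fun N : ℕ => t / √(N : ℝ)) atTop (𝓝 0) :=
    Tendsto.div_atTop tendsto_const_nhds
      (Real.tendsto_sqrt_atTop.comp tendsto_natCast_atTop_atTop)
  have hsq : (fun N : ℕ => (t / √(N : ℝ)) ^ 2) =O[atTop] fun N : ℕ => ((N : ℝ))⁻¹ := by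
    refine Asymptotics.IsBigO.of_bound (t ^ 2) (Eventually.of_forall fun N => ?_)
    simp only [norm_pow, norm_div, Real.norm_eq_abs, div_pow, sq_abs, norm_inv]
    rw [Real.sq_sqrt N.cast_nonneg, abs_of_nonneg (N.cast_nonneg : (0 : ℝ) ≤ N), div_eq_mul_inv]
  have h6 := (hlo.comp_tendsto hs).trans_isBigO hsq
  have h7 : Tendsto (fun N : ℕ => (N : ℂ) * (f (t / √(N : ℝ)) - 1)) atTop
      (𝓝 (c * (t : ℂ) ^ 2 / 2)) := by
    have h8 : Tendsto (fun N : ℕ => (N : ℂ) * (f (t / √(N : ℝ)) - 1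
        - c * ((t / √(N : ℝ) : ℝ) : ℂ) ^ 2 / 2)) atTop (𝓝 0) := by
      rw [tendsto_zero_iff_norm_tendsto_zero]
      refine h6.norm_left.tendsto_div_nhds_zero.congr fun N => ?_
      simp [mul_comm]
    have h9 := h8.add_const (c * (t : ℂ) ^ 2 / 2)
    rw [zero_add] at h9
    refine h9.congr' ((eventually_gt_atTop 0).mono fun N hN => ?_)
    have h10 : ((√(N : ℝ) : ℝ) : ℂ) ^ 2 = N := by
      rw [← Complex.ofReal_pow, Real.sq_sqrt N.cast_nonneg, Complex.ofReal_natCast]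
    have h11 : (N : ℂ) ≠ 0 := by exact_mod_cast hN.ne'
    push_cast
    rw [div_pow, h10]
    field_simp
    ring
  simpa using Complex.tendsto_one_add_pow_exp_of_tendsto h7

theorem two_sub_two_exp_le (a h : ℝ) : 2 - 2 * Real.exp (-(a * h ^ 2)) ≤ 2 * a * h ^ 2 := by
  linarith [Real.add_one_le_exp (-(a * h ^ 2))]

/-- With `x = exp (-a h²)`, `y = exp (-a k²)` and `w = a h k`, the left side is `4 (1 - x)(1 - y) +
2 x y (exp w - exp (-w))²`. The two terms are at most `4 w²` and `8 w²`. -/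
theorem gaussian_second_difference_le {a : ℝ} (ha : 0 ≤ a) (h k : ℝ) :
    4 - 4 * Real.exp (-(a * h ^ 2)) - 4 * Real.exp (-(a * k ^ 2))
      + 2 * Real.exp (-(a * (h + k) ^ 2)) + 2 * Real.exp (-(a * (h - k) ^ 2))
      ≤ 12 * a ^ 2 * h ^ 2 * k ^ 2 := by
  have key : ∀ w : ℝ, 0 ≤ w → Real.exp (-(2 * w)) * (Real.exp w - Real.exp (-w)) ^ 2
      ≤ 4 * w ^ 2 := fun w hw => by
    have e : Real.exp (-(2 * w)) * (Real.exp w - Real.exp (-w)) ^ 2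
        = (1 - Real.exp (-(2 * w))) ^ 2 := by
      rw [show -(2 * w) = -w + -w by ring, Real.exp_add]
      have : Real.exp (-w) * Real.exp w = 1 := by rw [← Real.exp_add]; simp
      linear_combination (Real.exp (-w) * Real.exp w + 1 - 2 * Real.exp (-w) ^ 2) * this
    rw [e, show 4 * w ^ 2 = (2 * w) ^ 2 by ring]
    have h1 := Real.add_one_le_exp (-(2 * w))
    have h2 : Real.exp (-(2 * w)) ≤ 1 := Real.exp_le_one_iff.2 (by linarith)
    exact pow_le_pow_left₀ (by linarith) (by linarith) 2
  set x := Real.exp (-(a * h ^ 2))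
  set y := Real.exp (-(a * k ^ 2))
  set w := a * h * k with hw
  have hp : Real.exp (-(a * (h + k) ^ 2)) = x * y * Real.exp (-w) ^ 2 := by
    rw [← Real.exp_add, ← Real.exp_nat_mul, ← Real.exp_add]; congr 1; push_cast; rw [hw]; ring
  have hm : Real.exp (-(a * (h - k) ^ 2)) = x * y * Real.exp w ^ 2 := by
    rw [← Real.exp_add, ← Real.exp_nat_mul, ← Real.exp_add]; congr 1; push_cast; rw [hw]; ring
  have h1 : Real.exp w * Real.exp (-w) = 1 := by rw [← Real.exp_add]; simp
  have hxy : x * y * (Real.exp w - Real.exp (-w)) ^ 2 ≤ 4 * w ^ 2 := by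
    -- This is `h² + k² ≥ 2 |h k|`; it absorbs the growth of `(exp w - exp (-w))²`.
    have hle : x * y ≤ Real.exp (-(2 * |w|)) := by
      rw [← Real.exp_add, Real.exp_le_exp]
      rcases abs_cases w with ⟨hw', _⟩ | ⟨hw', _⟩ <;> rw [hw', hw]
      · nlinarith [mul_nonneg ha (sq_nonneg (h - k))]
      · nlinarith [mul_nonneg ha (sq_nonneg (h + k))]
    have h2 : (Real.exp w - Real.exp (-w)) ^ 2 = (Real.exp |w| - Real.exp (-|w|)) ^ 2 := by
      rcases abs_cases w with ⟨h, _⟩ | ⟨h, _⟩ <;> rw [h]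
      rw [neg_neg]; ring
    rw [h2, ← sq_abs w]
    exact (mul_le_mul_of_nonneg_right hle (sq_nonneg _)).trans (key _ (abs_nonneg w))
  have hx1 : 1 - x ≤ a * h ^ 2 := by linarith [Real.add_one_le_exp (-(a * h ^ 2))]
  have hy1 : 1 - y ≤ a * k ^ 2 := by linarith [Real.add_one_le_exp (-(a * k ^ 2))]
  have hy0 : 0 ≤ 1 - y := sub_nonneg.2 (Real.exp_le_one_iff.2 (by nlinarith [sq_nonneg k]))
  have h3 : (1 - x) * (1 - y) ≤ a * h ^ 2 * (a * k ^ 2) :=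
    mul_le_mul hx1 hy1 hy0 (by positivity)
  rw [hp, hm]
  have h4 : x * y * (Real.exp w - Real.exp (-w)) ^ 2
      = x * y * Real.exp w ^ 2 + x * y * Real.exp (-w) ^ 2 - 2 * (x * y) := by
    linear_combination (-2 * x * y) * h1
  have h5 : w ^ 2 = a ^ 2 * h ^ 2 * k ^ 2 := by rw [hw]; ring
  nlinarith

end ScalarEstimates

/-! ### Unitary groups and the absorption of their generators -/

section OneParameterGroup

variable {H : Type*} [NormedAddCommGroup H] [InnerProductSpace ℂ H]

/-- If the difference quotients of `t ↦ T (U t x)` are bounded and converge on a dense subspace to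
`i T X`, then `T X` extends to a bounded operator and they converge everywhere. -/
theorem exists_extension_of_difference_bound [CompleteSpace H] {E : Type*} [AddCommGroup E]
    [Module ℂ E] {U : ℝ → H →L[ℂ] H} {e : E →ₗ[ℂ] H} {X : E →ₗ[ℂ] E} (he : DenseRange e)
    (hX : ∀ ψ, Tendsto (fun h : ℝ => (h : ℂ)⁻¹ • (U h (e ψ) - e ψ)) (𝓝[≠] 0)
      (𝓝 (Complex.I • e (X ψ))))
    {T : H →L[ℂ] H} {C : ℝ} (hT : ∀ h x, ‖T (U h x - x)‖ ≤ C * |h| * ‖x‖) :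
    ∃ T' : H →L[ℂ] H, (∀ ψ, T' (e ψ) = T (e (X ψ))) ∧
      ∀ x, Tendsto (fun h : ℝ => (h : ℂ)⁻¹ • T (U h x - x)) (𝓝[≠] 0)
        (𝓝 (Complex.I • T' x)) := by
  have hq : ∀ (h : ℝ) x, h ≠ 0 → ‖(h : ℂ)⁻¹ • T (U h x - x)‖ ≤ C * ‖x‖ := fun h x hh => by
    rw [norm_smul, norm_inv, Complex.norm_real, Real.norm_eq_abs,
      inv_mul_le_iff₀ (abs_pos.2 hh)]
    linarith [hT h x]
  have hlim : ∀ ψ, Tendsto (fun h : ℝ => (h : ℂ)⁻¹ • T (U h (e ψ) - e ψ)) (𝓝[≠] 0)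
      (𝓝 (Complex.I • T (e (X ψ)))) := fun ψ => by
    simpa [Function.comp_def] using (T.continuous.tendsto _).comp (hX ψ)
  -- The uniform bound survives the limit `h → 0`, so `T X` is bounded relative to `e` and extends
  -- by density.
  have hbound : ∀ ψ, ‖(T.toLinearMap ∘ₗ e ∘ₗ X) ψ‖ ≤ C * ‖e ψ‖ := fun ψ => by
    have h1 := le_of_tendsto (hlim ψ).norm (eventually_mem_nhdsWithin.mono fun h hh => hq h _ hh)
    simpa [norm_smul] using h1
  refine ⟨(T.toLinearMap ∘ₗ e ∘ₗ X).extendOfNorm e,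
    fun ψ => LinearMap.extendOfNorm_eq he ⟨C, hbound⟩ ψ, fun x => ?_⟩
  have hT'n := LinearMap.norm_extendOfNorm_apply_le he C hbound
  have hT'e := LinearMap.extendOfNorm_eq he ⟨C, hbound⟩
  set T' := (T.toLinearMap ∘ₗ e ∘ₗ X).extendOfNorm e
  rw [Metric.tendsto_nhds]
  intro ε hε
  obtain ⟨ψ, hψ⟩ := he.exists_dist_lt x (ε := ε / (4 * (|C| + 1))) (by positivity)
  have hC : ∀ y : H, ‖y‖ = dist x (e ψ) → C * ‖y‖ ≤ ε / 4 := fun y hy => by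
    rw [hy]
    calc C * dist x (e ψ) ≤ (|C| + 1) * (ε / (4 * (|C| + 1))) :=
          mul_le_mul ((le_abs_self C).trans (by linarith)) hψ.le dist_nonneg (by positivity)
      _ = ε / 4 := by field_simp
  filter_upwards [eventually_mem_nhdsWithin, (Metric.tendsto_nhds.1 (hlim ψ)) (ε / 4)
    (by positivity)] with h hh h2
  -- Approximating `x` by `e ψ` leaves three errors, each at most `ε / 4`.
  have e1 : (h : ℂ)⁻¹ • T (U h x - x) - Complex.I • T' x
      = (h : ℂ)⁻¹ • T (U h (x - e ψ) - (x - e ψ))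
        + ((h : ℂ)⁻¹ • T (U h (e ψ) - e ψ) - Complex.I • T (e (X ψ)))
        - Complex.I • T' (x - e ψ) := by
    have := hT'e ψ
    simp only [LinearMap.comp_apply, ContinuousLinearMap.coe_coe] at this
    simp only [map_sub, smul_sub, this]
    abel
  rw [dist_eq_norm] at h2 ⊢
  rw [e1]
  have h3 := (hq h (x - e ψ) hh).trans (hC _ (dist_eq_norm _ _).symm)
  have h4 : ‖Complex.I • T' (x - e ψ)‖ ≤ ε / 4 := by
    rw [norm_smul, Complex.norm_I, one_mul]
    exact (hT'n _).trans (hC _ (dist_eq_norm _ _).symm)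
  refine (norm_sub_le _ _).trans_lt ?_
  have := norm_add_le ((h : ℂ)⁻¹ • T (U h (x - e ψ) - (x - e ψ)))
    ((h : ℂ)⁻¹ • T (U h (e ψ) - e ψ) - Complex.I • T (e (X ψ)))
  linarith

variable [CompleteSpace H]

/-- A one-parameter group of unitary operators. -/
structure IsUnitaryGroup (U : ℝ → H →L[ℂ] H) : Prop where
  zero : U 0 = ContinuousLinearMap.id ℂ H
  add : ∀ s t, U (s + t) = U s ∘L U t
  adjoint : ∀ t, ContinuousLinearMap.adjoint (U t) = U (-t)

namespace IsUnitaryGroup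

variable {U : ℝ → H →L[ℂ] H} (hU : IsUnitaryGroup U)
include hU

theorem norm_apply (t : ℝ) (x : H) : ‖U t x‖ = ‖x‖ := by
  have h : ⟪U t x, U t x⟫_ℂ = ⟪x, x⟫_ℂ := by
    rw [← ContinuousLinearMap.adjoint_inner_right, hU.adjoint, ← ContinuousLinearMap.comp_apply,
      ← hU.add, neg_add_cancel, hU.zero, ContinuousLinearMap.id_apply]
  rw [inner_self_eq_norm_sq_to_K, inner_self_eq_norm_sq_to_K] at h
  exact (sq_eq_sq₀ (norm_nonneg _) (norm_nonneg _)).1 (by exact_mod_cast h)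

/-- The group law turns the difference quotient at `t` into the one at 0, applied to `U t x`. -/
theorem hasDerivAt_inner {T T' : H →L[ℂ] H}
    (h : ∀ x, Tendsto (fun h : ℝ => (h : ℂ)⁻¹ • T (U h x - x)) (𝓝[≠] 0) (𝓝 (Complex.I • T' x)))
    (v x : H) (t : ℝ) :
    HasDerivAt (fun t => ⟪v, T (U t x)⟫_ℂ) (Complex.I * ⟪v, T' (U t x)⟫_ℂ) t := by
  rw [hasDerivAt_iff_tendsto_slope_zero]
  have h1 := ((innerSL ℂ v).continuous.tendsto _).comp (h (U t x))
  simp only [map_smul, innerSL_apply_apply, smul_eq_mul] at h1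
  refine h1.congr fun s => ?_
  rw [add_comm t s, hU.add]
  simp [inner_sub_right, inner_smul_right]

/-- Differentiation under the trace. -/
theorem hasDerivAt_trace {T T' ρ : H →L[ℂ] H} (hρ : IsTraceClass ρ)
    (h : ∀ x, Tendsto (fun h : ℝ => (h : ℂ)⁻¹ • T (U h x - x)) (𝓝[≠] 0) (𝓝 (Complex.I • T' x)))
    (t : ℝ) :
    HasDerivAt (fun t => trace ((T ∘L U t) ∘L ρ)) (Complex.I * trace ((T' ∘L U t) ∘L ρ)) t := by
  obtain ⟨u, v, hn⟩ := hρ.exists_isNuclearSum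
  simp only [hn.trace_comp_left, ← tsum_mul_left]
  -- Unitarity makes the dominating series `‖T'‖ ‖u n‖ ‖v n‖` independent of time.
  refine hasDerivAt_tsum (hn.summable.mul_left ‖T'‖)
    (fun n s => hU.hasDerivAt_inner h (v n) (u n) s) (fun n s => ?_)
    (hn.summable_inner (T ∘L U 0)) t
  rw [norm_mul, Complex.norm_I, one_mul]
  calc ‖⟪v n, T' (U s (u n))⟫_ℂ‖ ≤ ‖v n‖ * (‖T'‖ * ‖u n‖) := by
        refine (norm_inner_le_norm _ _).trans ?_
        gcongr
        exact (T'.le_opNorm _).trans_eq (by rw [hU.norm_apply])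
    _ = _ := by ring

section Gaussian

variable {G : H →L[ℂ] H} (hG : G.IsPositive) (hc : IsTraceClass G) {a : ℝ}
  (ha : ∀ t, trace (U t ∘L G) = (Real.exp (-(a * t ^ 2)) : ℝ))
include hG hc ha

theorem norm_first_difference_sq_le (h : ℝ) (x : H) :
    ‖G (U h x - x)‖ ^ 2 ≤ ‖G‖ * (2 - 2 * Real.exp (-(a * h ^ 2))) * ‖x‖ ^ 2 := by
  have h1 := norm_comp_apply_sq_le hG hc (U h - 1) x
  have h2 : traceComp G hc ((U h - 1) ∘L ContinuousLinearMap.adjoint (U h - 1))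
      = ((2 - 2 * Real.exp (-(a * h ^ 2)) : ℝ) : ℂ) := by
    -- Writing the identity as `U 0` makes every product in the expansion a single `U s`, whose
    -- trace against `G` is known.
    have hz : (1 : H →L[ℂ] H) = U 0 := hU.zero.symm
    rw [hz]
    simp only [map_sub, hU.adjoint, ContinuousLinearMap.comp_sub, ContinuousLinearMap.sub_comp,
      ← hU.add, traceComp_apply, ha]
    push_cast
    ring_nf
    simp
  rw [traceComp_apply] at h2
  rw [h2, Complex.ofReal_re] at h1
  simpa using h1

theorem norm_second_difference_sq_le (h k : ℝ) (x : H) :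
    ‖G (U k (U h x - x) - (U h x - x))‖ ^ 2 ≤ ‖G‖ * (4 - 4 * Real.exp (-(a * h ^ 2))
      - 4 * Real.exp (-(a * k ^ 2)) + 2 * Real.exp (-(a * (h + k) ^ 2))
      + 2 * Real.exp (-(a * (h - k) ^ 2))) * ‖x‖ ^ 2 := by
  have h1 := norm_comp_apply_sq_le hG hc ((U k - 1) ∘L (U h - 1)) x
  have h2 : traceComp G hc (((U k - 1) ∘L (U h - 1)) ∘L
      ContinuousLinearMap.adjoint ((U k - 1) ∘L (U h - 1)))
      = ((4 - 4 * Real.exp (-(a * h ^ 2))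
      - 4 * Real.exp (-(a * k ^ 2)) + 2 * Real.exp (-(a * (h + k) ^ 2))
      + 2 * Real.exp (-(a * (h - k) ^ 2)) : ℝ) : ℂ) := by
    have hz : (1 : H →L[ℂ] H) = U 0 := hU.zero.symm
    rw [hz]
    simp only [map_sub, hU.adjoint, ContinuousLinearMap.comp_sub,
      ContinuousLinearMap.sub_comp, ← hU.add, traceComp_apply, ha]
    push_cast
    ring_nf
    simp
  rw [traceComp_apply] at h2
  rw [h2, Complex.ofReal_re] at h1
  exact h1

/-- The sign of the exponent is forced: the first-difference bound makes `2 - 2 exp (-a)`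
nonnegative, as `G ≠ 0`. -/
theorem gaussian_exponent_nonneg : 0 ≤ a := by
  have h1 : trace G = 1 := by
    have := ha 0
    rw [hU.zero] at this
    simpa using this
  have hG0 : G ≠ 0 := by
    rintro rfl
    simp [trace] at h1
  obtain ⟨x, hx⟩ : ∃ x, G x ≠ 0 := by
    by_contra! h
    exact hG0 (ContinuousLinearMap.ext h)
  have hx0 : x ≠ 0 := fun h => hx (by simp [h])
  have h2 := (sq_nonneg _).trans (hU.norm_first_difference_sq_le hG hc ha 1 x)
  have h3 : 0 < ‖G‖ := norm_pos_iff.2 hG0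
  have h4 : 0 < ‖x‖ ^ 2 := by positivity
  have h5 := nonneg_of_mul_nonneg_right (nonneg_of_mul_nonneg_left h2 h4) h3
  have h6 : Real.exp (-(a * 1 ^ 2)) ≤ 1 := by linarith
  simpa using h6

/-- A positive operator with Gaussian characteristic function along `U` absorbs the generator `X`
of `U` and its square. -/
theorem exists_generator_extensions {E : Type*} [AddCommGroup E] [Module ℂ E] {e : E →ₗ[ℂ] H}
    {X : E →ₗ[ℂ] E} (he : DenseRange e)
    (hX : ∀ ψ, Tendsto (fun h : ℝ => (h : ℂ)⁻¹ • (U h (e ψ) - e ψ)) (𝓝[≠] 0)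
      (𝓝 (Complex.I • e (X ψ)))) :
    ∃ T₁ T₂ : H →L[ℂ] H, (∀ ψ, T₁ (e ψ) = G (e (X ψ))) ∧ (∀ ψ, T₂ (e ψ) = G (e (X (X ψ)))) ∧
      (∀ x, Tendsto (fun h : ℝ => (h : ℂ)⁻¹ • G (U h x - x)) (𝓝[≠] 0) (𝓝 (Complex.I • T₁ x))) ∧
      ∀ x, Tendsto (fun h : ℝ => (h : ℂ)⁻¹ • T₁ (U h x - x)) (𝓝[≠] 0)
        (𝓝 (Complex.I • T₂ x)) := by
  have ha0 := hU.gaussian_exponent_nonneg hG hc ha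
  have hb1 : ∀ h x, ‖G (U h x - x)‖ ≤ √(2 * a * ‖G‖) * |h| * ‖x‖ := fun h x => by
    refine (sq_le_sq₀ (norm_nonneg _) (by positivity)).1 ?_
    rw [mul_pow, mul_pow, Real.sq_sqrt (by positivity), sq_abs]
    refine (hU.norm_first_difference_sq_le hG hc ha h x).trans ?_
    have := mul_le_mul_of_nonneg_left (two_sub_two_exp_le a h) (norm_nonneg G)
    calc _ ≤ ‖G‖ * (2 * a * h ^ 2) * ‖x‖ ^ 2 := by gcongr
      _ = _ := by ring
  obtain ⟨T₁, h1, h1'⟩ := exists_extension_of_difference_bound he hX hb1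
  -- Up to the factor `i`, `T₁ (U k x - x)` is the limit of second differences of `G` divided by
  -- `h`, so their bound of order `|h| |k|` yields one of order `|k|`.
  have hb2 : ∀ k x, ‖T₁ (U k x - x)‖ ≤ √(12 * ‖G‖) * a * |k| * ‖x‖ := fun k x => by
    have h2 := (h1' (U k x - x)).norm
    rw [norm_smul, Complex.norm_I, one_mul] at h2
    refine le_of_tendsto h2 (eventually_mem_nhdsWithin.mono fun h hh => ?_)
    rw [norm_smul, norm_inv, Complex.norm_real, Real.norm_eq_abs,
      inv_mul_le_iff₀ (abs_pos.2 hh)]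
    refine (sq_le_sq₀ (norm_nonneg _) (by positivity)).1 ?_
    simp only [mul_pow, sq_abs]
    rw [Real.sq_sqrt (by positivity)]
    refine (hU.norm_second_difference_sq_le hG hc ha k h x).trans ?_
    have := mul_le_mul_of_nonneg_left (gaussian_second_difference_le ha0 k h) (norm_nonneg G)
    calc _ ≤ ‖G‖ * (12 * a ^ 2 * k ^ 2 * h ^ 2) * ‖x‖ ^ 2 := by gcongr
      _ = _ := by ring
  obtain ⟨T₂, h2, h2'⟩ := exists_extension_of_difference_bound he hX hb2
  exact ⟨T₁, T₂, h1, fun ψ => by rw [h2, h1], h1', h2'⟩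

end Gaussian

end IsUnitaryGroup

end OneParameterGroup

/-! ### Displacement operators and their generators on Schwartz functions -/

section Displacement

theorem tendsto_eLpNorm_two_zero_of_dominated {α ι : Type*} [MeasurableSpace α] {μ : Measure α}
    {l : Filter ι} [l.IsCountablyGenerated] {F : ι → α → ℂ} {g : α → ℝ}
    (hF : ∀ᶠ h in l, AEStronglyMeasurable (F h) μ) (hg : MemLp g 2 μ)
    (hb : ∀ᶠ h in l, ∀ x, ‖F h x‖ ≤ g x) (hlim : ∀ x, Tendsto (fun h => F h x) l (𝓝 0)) :
    Tendsto (fun h => eLpNorm (F h) 2 μ) l (𝓝 0) := by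
  have e : ∀ {E : Type} [NormedAddCommGroup E] (f : α → E),
      eLpNorm f 2 μ = (∫⁻ x, ‖f x‖ₑ ^ (2 : ℝ) ∂μ) ^ (1 / (2 : ℝ)) := fun f => by
    simp [eLpNorm_eq_lintegral_rpow_enorm_toReal (p := 2) (by simp) (by simp)]
  have hfin : ∫⁻ x, ‖g x‖ₑ ^ (2 : ℝ) ∂μ ≠ ⊤ := by
    have := hg.2
    rw [e, ENNReal.rpow_lt_top_iff_of_pos (by norm_num)] at this
    exact this.ne
  have h1 : Tendsto (fun h => ∫⁻ x, ‖F h x‖ₑ ^ (2 : ℝ) ∂μ) l (𝓝 (∫⁻ _, 0 ∂μ)) := by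
    refine tendsto_lintegral_filter_of_dominated_convergence' (fun x => ‖g x‖ₑ ^ (2 : ℝ))
      (hF.mono fun h hh => hh.enorm.pow_const _) (hb.mono fun h hh => ?_) hfin ?_
    · refine Eventually.of_forall fun x => ?_
      gcongr
      exact enorm_le_iff_norm_le.2 ((hh x).trans (le_abs_self _))
    · refine Eventually.of_forall fun x => ?_
      have := ((continuous_enorm.tendsto _).comp (hlim x)).ennrpow_const (2 : ℝ)
      simpa [Function.comp_def] using this
  simp only [e]
  have := h1.ennrpow_const (1 / (2 : ℝ))
  simpa using this

/-- The square decays with exponent `2 (m + 1) > m`. This is the dominating function for difference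
quotients of Schwartz functions. -/
theorem memLp_one_add_norm_pow_inv (m : ℕ) :
    MemLp (fun x : Config m => ((1 + ‖x‖) ^ (m + 1))⁻¹) 2 volume := by
  have hc : Continuous fun x : Config m => ((1 + ‖x‖) ^ (m + 1))⁻¹ := by
    refine Continuous.inv₀ (by fun_prop) fun x => by positivity
  rw [memLp_two_iff_integrable_sq hc.aestronglyMeasurable]
  refine (integrable_one_add_norm (E := Config m) (μ := volume) (r := (2 * (m + 1) : ℕ))
    ?_).congr (Eventually.of_forall fun x => ?_)
  · rw [finrank_euclideanSpace_fin]
    push_cast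
    linarith [(m.cast_nonneg : (0 : ℝ) ≤ m)]
  · dsimp only
    rw [Real.rpow_neg (by positivity), Real.rpow_natCast, inv_pow, ← pow_mul, mul_comm 2]

variable {m : ℕ}

theorem schwartz_translate_bound (φ : 𝓢(Config m, ℂ)) (η : Config m) :
    ∃ K : ℝ, ∀ s : ℝ, |s| ≤ 1 → ∀ x, ‖φ (x + s • η)‖ ≤ K * ((1 + ‖x‖) ^ (m + 1))⁻¹ := by
  obtain ⟨C, hC⟩ : ∃ C : ℝ, ∀ x, (1 + ‖x‖) ^ (m + 1) * ‖φ x‖ ≤ C :=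
    ⟨_, fun x => by
      simpa using SchwartzMap.one_add_le_sup_seminorm_apply (𝕜 := ℂ) (m := (m + 1, 0))
        (le_refl (m + 1)) le_rfl φ x⟩
  refine ⟨(1 + ‖η‖) ^ (m + 1) * C, fun s hs x => ?_⟩
  rw [← div_eq_mul_inv, le_div_iff₀ (by positivity)]
  -- A Peetre-type inequality: a bounded translation costs only a constant factor in the weight.
  have h1 : 1 + ‖x‖ ≤ (1 + ‖η‖) * (1 + ‖x + s • η‖) := by
    have h2 : ‖x‖ ≤ ‖x + s • η‖ + ‖η‖ := by
      calc ‖x‖ = ‖(x + s • η) - s • η‖ := by rw [add_sub_cancel_right]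
        _ ≤ ‖x + s • η‖ + ‖s • η‖ := norm_sub_le _ _
        _ ≤ _ := by
          rw [norm_smul, Real.norm_eq_abs]
          gcongr
          exact mul_le_of_le_one_left (norm_nonneg _) hs
    nlinarith [norm_nonneg η, norm_nonneg (x + s • η)]
  calc ‖φ (x + s • η)‖ * (1 + ‖x‖) ^ (m + 1)
      ≤ ‖φ (x + s • η)‖ * ((1 + ‖η‖) * (1 + ‖x + s • η‖)) ^ (m + 1) := by gcongr
    _ = (1 + ‖η‖) ^ (m + 1) * ((1 + ‖x + s • η‖) ^ (m + 1) * ‖φ (x + s • η)‖) := by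
      rw [mul_pow]; ring
    _ ≤ _ := by gcongr; exact hC _

theorem weylPhase_smul (t : ℝ) (r : PhaseSpace m) (x : Config m) :
    weylPhase (t • r) x = Complex.exp (Complex.I *
      ((t * ⟪posPart r, x⟫_ℝ + t ^ 2 * ⟪posPart r, momPart r⟫_ℝ / 2 : ℝ) : ℂ)) := by
  have h1 : posPart (t • r) = t • posPart r := rfl
  have h2 : momPart (t • r) = t • momPart r := rfl
  rw [weylPhase, h1, h2, real_inner_smul_left, real_inner_smul_left, real_inner_smul_right]
  congr 4
  ring

theorem momPart_smul (t : ℝ) (r : PhaseSpace m) : momPart (t • r) = t • momPart r := rfl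

theorem norm_D_apply (r : PhaseSpace m) (ψ : Fock m) : ‖D r ψ‖ = ‖ψ‖ := by
  rw [D, LinearIsometry.coe_toContinuousLinearMap]
  exact LinearIsometry.norm_map (_ : Fock m →ₗᵢ[ℂ] Fock m) ψ

/-- The displacement operators along a fixed direction form a one-parameter unitary group. -/
theorem isUnitaryGroup_D (r : PhaseSpace m) : IsUnitaryGroup fun t : ℝ => D (t • r) := by
  have hzero : D ((0 : ℝ) • r) = ContinuousLinearMap.id ℂ (Fock m) := by
    refine ContinuousLinearMap.ext fun ψ => Lp.ext ?_
    filter_upwards [coeFn_D ((0 : ℝ) • r) ψ] with x hx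
    rw [hx, weylPhase_smul, momPart_smul]
    simp
  have hadd : ∀ s t : ℝ, D ((s + t) • r) = D (s • r) ∘L D (t • r) := fun s t => by
    refine ContinuousLinearMap.ext fun ψ => Lp.ext ?_
    have h := (measurePreserving_add_right volume (momPart (s • r))).quasiMeasurePreserving.ae
      (coeFn_D (t • r) ψ)
    rw [ContinuousLinearMap.comp_apply]
    filter_upwards [coeFn_D ((s + t) • r) ψ, coeFn_D (s • r) (D (t • r) ψ), h] with x h1 h2 h3
    rw [h1, h2, h3, ← mul_assoc, weylPhase_smul]
    -- The translation by `s η` contributes the cross term `s t ξ · η`, which completes `s²/2 +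
    -- t²/2` to `(s + t)²/2`.
    simp only [weylPhase_smul, momPart_smul, ← Complex.exp_add, add_smul, add_assoc, inner_add_right,
      real_inner_smul_right]
    congr 2
    push_cast
    ring
  refine ⟨hzero, hadd, fun t => ?_⟩
  refine ((ContinuousLinearMap.eq_adjoint_iff _ _).2 fun x y => ?_).symm
  have hy : D (t • r) (D (-t • r) x) = x := by
    rw [← ContinuousLinearMap.comp_apply, ← hadd, add_neg_cancel, hzero,
      ContinuousLinearMap.id_apply]
  have h := LinearIsometry.inner_map_map (𝕜 := ℂ) (E := Fock m) (E' := Fock m)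
    ⟨(D (t • r)).toLinearMap, norm_D_apply _⟩ (D (-t • r) x) y
  change ⟪D (t • r) (D (-t • r) x), D (t • r) y⟫_ℂ = _ at h
  rw [← h, hy]

/-- The quadrature `r · R` on the Schwartz space. -/
def quadrature (r : PhaseSpace m) : 𝓢(Config m, ℂ) →L[ℂ] 𝓢(Config m, ℂ) :=
  ∑ j, (r j : ℂ) • R j

theorem quadrature_apply (r : PhaseSpace m) (ψ : 𝓢(Config m, ℂ)) (x : Config m) :
    quadrature r ψ x =
      (⟪posPart r, x⟫_ℝ : ℂ) * ψ x - Complex.I * fderiv ℝ ψ x (momPart r) := by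
  have hm : momPart r = ∑ j, r (j, 1) • EuclideanSpace.single j (1 : ℝ) := by
    ext i
    simp [momPart, Pi.single_apply]
  have hl : ∀ j, lineDeriv ℝ ψ x (EuclideanSpace.single j (1 : ℝ))
      = fderiv ℝ ψ x (EuclideanSpace.single j (1 : ℝ)) := fun j =>
    ψ.differentiableAt.lineDeriv_eq_fderiv
  have h1 : quadrature r ψ x = ∑ j, (r j : ℂ) * R j ψ x := by
    simp [quadrature]
  rw [h1, Fintype.sum_prod_type, hm, map_sum]
  simp only [Fin.sum_univ_two, R_pos_apply, R_mom_apply, hl, map_smul, Complex.real_smul,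
    Finset.sum_add_distrib, PiLp.inner_apply, posPart, Finset.mul_sum, sub_eq_add_neg,
    ← Finset.sum_neg_distrib, Complex.ofReal_sum, Finset.sum_mul]
  congr 1
  · refine Finset.sum_congr rfl fun j _ => ?_
    simp
    ring
  · refine Finset.sum_congr rfl fun j _ => ?_
    ring

theorem hasDerivAt_displaced (r : PhaseSpace m) (ψ : 𝓢(Config m, ℂ)) (x : Config m) (t : ℝ) :
    HasDerivAt (fun t : ℝ => weylPhase (t • r) x * ψ (x + t • momPart r))
      (Complex.I * (weylPhase (t • r) x * quadrature r ψ (x + t • momPart r))) t := by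
  simp only [weylPhase_smul, quadrature_apply]
  have h1 : HasDerivAt (fun t : ℝ => x + t • momPart r) (momPart r) t := by
    simpa using ((hasDerivAt_id t).smul_const (momPart r)).const_add x
  have h2 := (ψ.differentiableAt (x := x + t • momPart r)).hasFDerivAt.comp_hasDerivAt t h1
  have h3 : HasDerivAt
      (fun t : ℝ => t * ⟪posPart r, x⟫_ℝ + t ^ 2 * ⟪posPart r, momPart r⟫_ℝ / 2)
      (⟪posPart r, x + t • momPart r⟫_ℝ) t := by
    refine (((hasDerivAt_id t).mul_const _).add
      ((((hasDerivAt_id t).fun_pow 2).mul_const _).div_const 2)).congr_deriv ?_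
    simp [inner_add_right, real_inner_smul_right]
    ring
  have h4 := ((h3.ofReal_comp.const_mul Complex.I).cexp).mul h2
  refine h4.congr_deriv ?_
  simp only [Function.comp_def]
  linear_combination (Complex.exp (Complex.I *
      ((t * ⟪posPart r, x⟫_ℝ + t ^ 2 * ⟪posPart r, momPart r⟫_ℝ / 2 : ℝ) : ℂ))
      * fderiv ℝ ψ (x + t • momPart r) (momPart r)) * Complex.I_mul_I

/-- On Schwartz functions, `r · R` is the generator of `t ↦ D (t r)`. -/
theorem tendsto_difference_quotient_D (r : PhaseSpace m) (ψ : 𝓢(Config m, ℂ)) :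
    Tendsto (fun h : ℝ => (h : ℂ)⁻¹ • (D (h • r) (ψ.toLp 2 volume) - ψ.toLp 2 volume)) (𝓝[≠] 0)
      (𝓝 (Complex.I • (quadrature r ψ).toLp 2 volume)) := by
  set φ := quadrature r ψ
  obtain ⟨K, hK⟩ := schwartz_translate_bound φ (momPart r)
  set g : Config m → ℝ := fun x => ((1 + ‖x‖) ^ (m + 1))⁻¹
  let F : ℝ → Config m → ℂ := fun h x =>
    (h : ℂ)⁻¹ * (weylPhase (h • r) x * ψ (x + h • momPart r) - ψ x) - Complex.I * φ x
  have hF : ∀ h : ℝ, ⇑((h : ℂ)⁻¹ • (D (h • r) (ψ.toLp 2 volume) - ψ.toLp 2 volume))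
      - ⇑(Complex.I • φ.toLp 2 volume) =ᵐ[volume] F h := fun h => by
    have h1 := (measurePreserving_add_right volume (momPart (h • r))).quasiMeasurePreserving.ae
      (ψ.coeFn_toLp 2 volume)
    filter_upwards [Lp.coeFn_smul ((h : ℂ)⁻¹) (D (h • r) (ψ.toLp 2 volume) - ψ.toLp 2 volume),
      Lp.coeFn_sub (D (h • r) (ψ.toLp 2 volume)) (ψ.toLp 2 volume),
      Lp.coeFn_smul Complex.I (φ.toLp 2 volume), coeFn_D (h • r) (ψ.toLp 2 volume),
      ψ.coeFn_toLp 2 volume, φ.coeFn_toLp 2 volume, h1] with x a1 a2 a3 a4 a5 a6 a7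
    simp only [Pi.sub_apply, a1, a2, a3, a4, a5, a6, Pi.smul_apply, smul_eq_mul, F]
    rw [a7, momPart_smul]
  rw [Lp.tendsto_Lp_iff_tendsto_eLpNorm']
  refine Tendsto.congr (fun h => (eLpNorm_congr_ae (hF h)).symm) ?_
  -- One `K * g x` bounds the difference quotient, by the mean value inequality, and the other its
  -- limit.
  refine tendsto_eLpNorm_two_zero_of_dominated (g := fun x => 2 * K * g x)
    (Eventually.of_forall fun h => ?_) ((memLp_one_add_norm_pow_inv m).const_mul _) ?_
    fun x => ?_
  · have := continuous_weylPhase (h • r)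
    exact Continuous.aestronglyMeasurable (by fun_prop)
  · have h1 : ∀ᶠ h : ℝ in 𝓝[≠] 0, |h| ≤ 1 := by
      filter_upwards [nhdsWithin_le_nhds (Metric.closedBall_mem_nhds (0 : ℝ) one_pos)] with h hh
      simpa using hh
    filter_upwards [h1, eventually_mem_nhdsWithin] with h hh h0 x
    have hd := (convex_closedBall (0 : ℝ) |h|).norm_image_sub_le_of_norm_hasDerivWithin_le
      (fun t _ => (hasDerivAt_displaced r ψ x t).hasDerivWithinAt) (C := K * g x) (fun t ht => by
        rw [norm_mul, Complex.norm_I, one_mul, norm_mul, norm_weylPhase, one_mul]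
        exact hK t (le_trans (by simpa using ht) hh) x) (x := 0) (y := h) (by simp) (by simp)
    have hz : weylPhase ((0 : ℝ) • r) x = 1 := by rw [weylPhase_smul]; simp
    rw [hz, one_mul, zero_smul, add_zero, sub_zero] at hd
    have h2 : ‖(h : ℂ)⁻¹ * (weylPhase (h • r) x * ψ (x + h • momPart r) - ψ x)‖ ≤ K * g x := by
      rw [norm_mul, norm_inv, Complex.norm_real, inv_mul_le_iff₀ (norm_pos_iff.2 h0)]
      exact hd.trans_eq (mul_comm _ _)
    have h3 : ‖Complex.I * φ x‖ ≤ K * g x := by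
      rw [norm_mul, Complex.norm_I, one_mul]
      simpa using hK 0 (by simp) x
    refine (norm_sub_le _ _).trans ?_
    linarith
  · have hd := (hasDerivAt_displaced r ψ x 0).tendsto_slope_zero
    have hz : weylPhase (0 : PhaseSpace m) x = 1 := by
      simpa using weylPhase_smul 0 (0 : PhaseSpace m) x
    simp only [hz, zero_add, one_mul, zero_smul, add_zero] at hd
    have := hd.sub_const (Complex.I * φ x)
    rw [sub_self] at this
    refine this.congr fun h => ?_
    simp [F]

end Displacement

/-! ### Finite moments of filtered operators and the limit theorem -/

section Moments

variable {m : ℕ}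

/-- The bounded operator `B` extends `G q` from the Schwartz space. -/
def IsBoundedExtension (G : Fock m →L[ℂ] Fock m) (q : 𝓢(Config m, ℂ) →L[ℂ] 𝓢(Config m, ℂ))
    (B : Fock m →L[ℂ] Fock m) : Prop :=
  ∀ ψ : 𝓢(Config m, ℂ), B (ψ.toLp 2) = G ((q ψ).toLp 2)

theorem denseRange_schwartz :
    DenseRange fun ψ : 𝓢(Config m, ℂ) => (ψ.toLp 2 volume : Fock m) :=
  SchwartzMap.denseRange_toLpCLM (E := Config m) (F := ℂ) (p := 2) ENNReal.ofNat_ne_top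

theorem eq_of_eq_on_schwartz {A B : Fock m →L[ℂ] Fock m}
    (h : ∀ ψ : 𝓢(Config m, ℂ), A (ψ.toLp 2) = B (ψ.toLp 2)) : A = B :=
  DFunLike.coe_injective (denseRange_schwartz.equalizer A.continuous B.continuous (funext h))

/-- By density the extension is unique, so any one of them computes the moment. -/
theorem moment_eq_trace {A T : Fock m →L[ℂ] Fock m}
    {q : 𝓢(Config m, ℂ) →L[ℂ] 𝓢(Config m, ℂ)} (h : IsMomentOperator A q T) :
    moment A q = trace T := by
  have hA : HasFiniteMoment A q := ⟨T, h⟩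
  rw [moment, dif_pos hA]
  congr 1
  exact eq_of_eq_on_schwartz fun ψ => (hA.choose_spec.2 ψ).trans (h.2 ψ).symm

namespace IsBoundedExtension

variable {G B C : Fock m →L[ℂ] Fock m} {q p : 𝓢(Config m, ℂ) →L[ℂ] 𝓢(Config m, ℂ)}

theorem unique (hB : IsBoundedExtension G q B) (hC : IsBoundedExtension G q C) : B = C :=
  eq_of_eq_on_schwartz fun ψ => (hB ψ).trans (hC ψ).symm

theorem add (hB : IsBoundedExtension G q B) (hC : IsBoundedExtension G p C) :
    IsBoundedExtension G (q + p) (B + C) := fun ψ => by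
  rw [add_apply, hB, hC, ← map_add]
  rfl

theorem smul (hB : IsBoundedExtension G q B) (c : ℂ) :
    IsBoundedExtension G (c • q) (c • B) := fun ψ => by
  rw [smul_apply, hB, ← map_smul]
  rfl

theorem sub (hB : IsBoundedExtension G q B) (hC : IsBoundedExtension G p C) :
    IsBoundedExtension G (q - p) (B - C) := fun ψ => by
  rw [sub_apply, hB, hC, ← map_sub]
  rfl

theorem zero : IsBoundedExtension G 0 0 := fun ψ => by
  change (0 : Fock m) = G ((SchwartzMap.toLpCLM ℂ ℂ 2 volume) 0)
  rw [map_zero, map_zero]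

theorem sum {ι : Type*} (s : Finset ι) {q : ι → 𝓢(Config m, ℂ) →L[ℂ] 𝓢(Config m, ℂ)}
    {B : ι → Fock m →L[ℂ] Fock m} (h : ∀ i ∈ s, IsBoundedExtension G (q i) (B i)) :
    IsBoundedExtension G (∑ i ∈ s, q i) (∑ i ∈ s, B i) := by
  classical
  induction s using Finset.induction_on with
  | empty => exact zero
  | insert i s hi ih =>
    rw [Finset.sum_insert hi, Finset.sum_insert hi]
    exact (h i (Finset.mem_insert_self i s)).add
      (ih fun k hk => h k (Finset.mem_insert_of_mem hk))

theorem isMomentOperator {ρ : Fock m →L[ℂ] Fock m} (hB : IsBoundedExtension G q B)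
    (hρ : IsTraceClass ρ) (κ : ℂ) : IsMomentOperator (κ • (ρ ∘L G)) q (κ • (ρ ∘L B)) :=
  ⟨(hρ.comp_right B).smul κ, fun ψ => by simp [hB ψ]⟩

theorem moment_eq {ρ : Fock m →L[ℂ] Fock m} (hB : IsBoundedExtension G q B)
    (hρ : IsTraceClass ρ) (κ : ℂ) : moment (κ • (ρ ∘L G)) q = κ * traceComp ρ hρ B := by
  rw [moment_eq_trace (hB.isMomentOperator hρ κ), trace_smul, hρ.trace_comp_comm,
    traceComp_apply]

end IsBoundedExtension

/-- A Gaussian state absorbs every quadrature and its square. -/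
theorem IsCentredGaussianState.exists_extensions {G : Fock m →L[ℂ] Fock m}
    (hG : IsCentredGaussianState G) (r : PhaseSpace m) :
    ∃ T₁ T₂ : Fock m →L[ℂ] Fock m, IsBoundedExtension G (quadrature r) T₁ ∧
      IsBoundedExtension G (quadrature r ∘L quadrature r) T₂ ∧
      (∀ x, Tendsto (fun h : ℝ => (h : ℂ)⁻¹ • G (D (h • r) x - x)) (𝓝[≠] 0)
        (𝓝 (Complex.I • T₁ x))) ∧
      ∀ x, Tendsto (fun h : ℝ => (h : ℂ)⁻¹ • T₁ (D (h • r) x - x)) (𝓝[≠] 0)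
        (𝓝 (Complex.I • T₂ x)) := by
  obtain ⟨hρ, Γ, -, hΓ⟩ := hG
  refine (isUnitaryGroup_D r).exists_generator_extensions hρ.isPositive hρ.isTraceClass
    (a := (r ⬝ᵥ Γ.mulVec r) / 4) (fun t => ?_)
    (e := (SchwartzMap.toLpCLM ℂ ℂ 2 volume).toLinearMap) (X := (quadrature r).toLinearMap)
    denseRange_schwartz (tendsto_difference_quotient_D r)
  have := hΓ (t • r)
  rw [charFn] at this
  rw [this, Complex.ofReal_exp]
  congr 1
  simp only [Matrix.mulVec_smul, smul_dotProduct, dotProduct_smul, smul_eq_mul]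
  push_cast
  ring

theorem quadrature_add (r s : PhaseSpace m) :
    quadrature (r + s) = quadrature r + quadrature s := by
  simp [quadrature, add_smul, Finset.sum_add_distrib]

theorem quadrature_single (j : Coord m) : quadrature (Pi.single j 1 : PhaseSpace m) = R j := by
  rw [quadrature, Finset.sum_eq_single j (fun k _ hk => by simp [hk]) (by simp)]
  simp

/-- Polarization: `{R_j, R_k}₊ = (R_j + R_k)² - R_j² - R_k²`, so squares of quadratures suffice. -/
theorem IsCentredGaussianState.exists_anticomm_extension {G : Fock m →L[ℂ] Fock m}
    (hG : IsCentredGaussianState G) (j k : Coord m) :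
    ∃ B, IsBoundedExtension G (centredAnticomm 0 j k) B := by
  obtain ⟨-, T, -, hT, -⟩ := hG.exists_extensions (Pi.single j 1 + Pi.single k 1)
  obtain ⟨-, Tj, -, hj, -⟩ := hG.exists_extensions (Pi.single j 1)
  obtain ⟨-, Tk, -, hk, -⟩ := hG.exists_extensions (Pi.single k 1)
  refine ⟨T - Tj - Tk, ?_⟩
  have e : centredAnticomm 0 j k =
      quadrature (Pi.single j 1 + Pi.single k 1) ∘L quadrature (Pi.single j 1 + Pi.single k 1)
        - quadrature (Pi.single j 1) ∘L quadrature (Pi.single j 1)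
        - quadrature (Pi.single k 1) ∘L quadrature (Pi.single k 1 : PhaseSpace m) := by
    simp only [centredAnticomm, quadrature_add, quadrature_single, Pi.zero_apply, zero_smul,
      sub_zero, ContinuousLinearMap.add_comp, ContinuousLinearMap.comp_add]
    abel
  rw [e]
  exact (hT.sub hj).sub hk

theorem sum_centredAnticomm (r : PhaseSpace m) :
    ∑ j, ∑ k, ((r j : ℂ) * (r k : ℂ)) • centredAnticomm 0 j k
      = (2 : ℂ) • (quadrature r ∘L quadrature r) := by
  have h1 : quadrature r ∘L quadrature r
      = ∑ j, ∑ k, ((r j : ℂ) * (r k : ℂ)) • (R j ∘L R k) := by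
    refine ContinuousLinearMap.ext fun ψ => ?_
    simp only [quadrature, ContinuousLinearMap.comp_apply, sum_apply, smul_apply, map_sum,
      map_smul, Finset.smul_sum, smul_smul]
    rw [Finset.sum_comm]
    simp only [mul_comm]
  have h2 : ∑ j, ∑ k, ((r j : ℂ) * (r k : ℂ)) • (R k ∘L R j)
      = ∑ j, ∑ k, ((r j : ℂ) * (r k : ℂ)) • (R j ∘L R k) := by
    rw [Finset.sum_comm]
    simp only [mul_comm]
  simp only [centredAnticomm, Pi.zero_apply, zero_smul, sub_zero, smul_add,
    Finset.sum_add_distrib, h2, ← h1, two_smul]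

/-- Cyclicity puts the displacement directly to the right of `G`, where its difference quotients are
controlled. -/
theorem charFn_smul_comp {ρ G : Fock m →L[ℂ] Fock m} (hρ : IsTraceClass ρ) (κ : ℂ)
    (r : PhaseSpace m) : charFn (κ • (ρ ∘L G)) r = κ * trace ((G ∘L D r) ∘L ρ) := by
  rw [charFn, ContinuousLinearMap.comp_smul, trace_smul, ← (hρ.comp_right G).trace_comp_comm,
    ContinuousLinearMap.comp_assoc, hρ.trace_comp_comm]

theorem filtered_gaussian_central_limit {ρ G : Fock m →L[ℂ] Fock m} (hρ : IsTraceClass ρ)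
    (hG : IsCentredGaussianState G) {κ : ℂ} (h1 : κ * trace (ρ ∘L G) = 1)
    (hd : ∀ j, displacement (κ • (ρ ∘L G)) j = 0) (r₀ : PhaseSpace m) :
    HasFiniteSecondMoments (κ • (ρ ∘L G)) ∧
      ∀ t : ℝ, Tendsto (fun N : ℕ => charFn (κ • (ρ ∘L G)) ((t / √(N : ℝ)) • r₀) ^ N) atTop
        (𝓝 (Complex.exp (-(secondMoment (κ • (ρ ∘L G)) r₀) * (t : ℂ) ^ 2 / 4))) := by
  have hd0 : displacement (κ • (ρ ∘L G)) = 0 := funext hd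
  choose B hB using hG.exists_anticomm_extension
  have hfirst : ∀ j : Coord m, ∃ T, IsBoundedExtension G (R j) T := fun j => by
    obtain ⟨T, -, hT, -⟩ := hG.exists_extensions (Pi.single j 1)
    exact ⟨T, quadrature_single j ▸ hT⟩
  choose S hS using hfirst
  refine ⟨⟨fun j => ⟨_, (hS j).isMomentOperator hρ κ⟩, fun j k => ?_⟩, ?_⟩
  · rw [hd0]
    exact ⟨_, (hB j k).isMomentOperator hρ κ⟩
  obtain ⟨T₁, T₂, hT₁, hT₂, hlim₁, hlim₂⟩ := hG.exists_extensions r₀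
  have hT₁0 : κ * traceComp ρ hρ T₁ = 0 := by
    have e : T₁ = ∑ j, (r₀ j : ℂ) • S j :=
      hT₁.unique (IsBoundedExtension.sum _ fun j _ => (hS j).smul _)
    rw [e, map_sum, Finset.mul_sum]
    refine Finset.sum_eq_zero fun j _ => ?_
    have := hd j
    rw [displacement, (hS j).moment_eq hρ κ] at this
    rw [map_smul, smul_eq_mul, mul_left_comm, this, mul_zero]
  -- The factor 2 comes from the anticommutator, which carries no `1/2`.
  have hν : secondMoment (κ • (ρ ∘L G)) r₀ = 2 * (κ * traceComp ρ hρ T₂) := by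
    have e : (2 : ℂ) • T₂ = ∑ j, ∑ k, ((r₀ j : ℂ) * (r₀ k : ℂ)) • B j k := by
      refine (hT₂.smul 2).unique ?_
      rw [← sum_centredAnticomm]
      exact IsBoundedExtension.sum _ fun j _ => IsBoundedExtension.sum _ fun k _ =>
        (hB j k).smul _
    have e' := congrArg (fun A => κ * traceComp ρ hρ A) e
    simp only [map_smul, map_sum, smul_eq_mul] at e'
    rw [← mul_assoc, mul_comm 2, mul_assoc, e']
    simp only [secondMoment, covarianceMatrix, hd0, dotProduct, Matrix.mulVec, Matrix.of_apply,
      (hB _ _).moment_eq hρ κ, Finset.mul_sum]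
    refine Finset.sum_congr rfl fun j _ => Finset.sum_congr rfl fun k _ => ?_
    ring
  have hU := isUnitaryGroup_D r₀
  have hz : D ((0 : ℝ) • r₀) = ContinuousLinearMap.id ℂ (Fock m) := hU.zero
  intro t
  have hf := fun s : ℝ => (hU.hasDerivAt_trace hρ hlim₁ s).const_mul κ
  have hf' := ((hU.hasDerivAt_trace hρ hlim₂ 0).const_mul Complex.I).const_mul κ
  simp only [charFn_smul_comp hρ]
  rw [traceComp_apply] at hT₁0 hν
  -- Here `c = i² κ tr (T₂ ρ) = -ν/2`, and `f'(0)` vanishes because the displacement does.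
  convert tendsto_pow_of_hasDerivAt hf hf' ?_ ?_ t using 3
  · rw [hz, ContinuousLinearMap.comp_id, hν]
    linear_combination
      (-(κ * trace (T₂ ∘L ρ)) * (t : ℂ) ^ 2 / 2) * Complex.I_mul_I
  · rw [hz, ContinuousLinearMap.comp_id, ← hρ.trace_comp_comm, h1]
  · rw [hz, ContinuousLinearMap.comp_id, mul_left_comm, hT₁0, mul_zero]

end Moments

end Gaussification

end

theorem mainTheorem3 (m : ℕ) (ρ P : Gaussification.Fock m →L[ℂ] Gaussification.Fock m)
    (hρ : Gaussification.IsDensityOperator ρ) (hP : Gaussification.IsGaussianFilter P)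
    (htr : Gaussification.trace (ρ ∘L P) ≠ 0)
    (hd : ∀ j, Gaussification.displacement (Gaussification.filtered ρ P) j = 0)
    (r₀ : Gaussification.PhaseSpace m)
    (hf : ∀ t : ℝ, ‖Gaussification.charFn (Gaussification.filtered ρ P) (t • r₀)‖ ≤ 1) :
    Gaussification.HasFiniteSecondMoments (Gaussification.filtered ρ P) ∧
      ∀ t : ℝ, Tendsto
        (fun N : ℕ => Gaussification.charFn (Gaussification.filtered ρ P) ((t / √(N : ℝ)) • r₀) ^ N)
        atTop
        (𝓝 (Complex.exp
          (-(Gaussification.secondMoment (Gaussification.filtered ρ P) r₀) * (t : ℂ) ^ 2 / 4))) := by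
  obtain ⟨c, G, -, hG, rfl⟩ := hP
  have e : Gaussification.filtered ρ ((c : ℂ) • G)
      = ((Gaussification.trace (ρ ∘L ((c : ℂ) • G)))⁻¹ * (c : ℂ)) • (ρ ∘L G) := by
    rw [Gaussification.filtered, ContinuousLinearMap.comp_smul, smul_smul]
  rw [e] at hd ⊢
  refine Gaussification.filtered_gaussian_central_limit hρ.isTraceClass hG ?_ hd r₀
  rw [mul_assoc, ← Gaussification.trace_smul, ← ContinuousLinearMap.comp_smul]
  exact inv_mul_cancel₀ htr
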